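/- Let $A_1,\dots,A_m,B$ be real symmetric $n\times n$ matrices such that the semidefinite program $$(P)\qquad x_1A_1+\dots+x_mA_m+B\succeq 0$$ is strictly feasible, i.e. $\sum_i x_iA_i+B\succ 0$ for some $x\in\mathbb R^m$. A *reformulation* of $(P)$ is a program obtained from it by finitely many of the following operations: exchange $A_i$ and $A_j$; replace $A_i$ by $\lambda A_i+\mu A_j$ with $\lambda\neq 0$ and $j\ne i$ (or by $\lambda A_i$, $\lambda\ne0$); replace all $A_i$ by $T^\top A_iT$ and $B$ by $T^\top BT$ with $T$ invertible. A sequence $(C_1,\dots,C_k)$ of symmetric $n\times n$ matrices is a *regular facial reduction sequence* with block sizes $r_1,\dots,r_k\ge 0$, $r_1+\dots+r_k\le n$, if for each $i$ deleting the first $r_1+\dots+r_{i-1}$ rows and columns of $C_i$ leaves $\begin{pmatrix} I_{r_i}&0\\0&0\end{pmatrix}$. Call an integer $k$ with $0\le k\le m$ *admissible* if $(P)$ has a reformulation $$(P')\qquad x_1A_1'+\dots+x_mA_m'+B'\succeq 0$$ such that $(A_1',\dots,A_k')$ is a regular facial reduction sequence, with block sizes $r_1,\dots,r_k$ for which $n-r_1-\dots-r_k$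 is the maximum rank of a matrix in $\{Y\succeq 0 : \operatorname{trace}(A_iY)=0,\ i=1,\dots,m\}$. Let $k$ be the smallest admissible integer, let $(P')$ be a reformulation as above with this $k$, and fix a partially strictly feasible $(\bar x_{k+1},\dots,\bar x_m)$, i.e. one for which some $(x_1,\dots,x_k)$ makes $(x_1,\dots,x_k,\bar x_{k+1},\dots,\bar x_m)$ strictly feasible in $(P')$. Then: 1. If $k\ge 1$, for every $M\in\mathbb R$ there is $(x_1,\dots,x_k)$ with $x_k\ge M$ such that $(x_1,\dots,x_k,\bar x_{k+1},\dots,\bar x_m)$ is strictly feasible in $(P')$. 2. There are constants $d_2,\dots,d_k>0$ and $\alpha_2,\dots,\alpha_k$ with $$2\ \ge\ \alpha_{j+1}\ \ge\ 1+\frac1{k-j}\qquad (j=1,\dots,k-1)$$ and a constant $K$, all depending only on the programs $(P)$, $(P')$ and on $\bar x_{k+1},\dots,\bar x_m$, such that whenever $(x_1,\dots,x_k,\bar x_{k+1},\dots,\bar x_m)$ is strictly feasible in $(P')$ and $x_k\ge K$, the numbers $x_1,\dots,x_k$ are positive and $$x_j\ \ge\ d_{j+1}\,x_{j+1}^{\alpha_{j+1}}\qquad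 (j=1,\dots,k-1).$$ -/

import Mathlib

open Matrix

/-- The matrix `∑ i, x i • A i + B` that a semidefinite program constrains to be psd. -/
def slack {m n : ℕ} (A : Fin m → Matrix (Fin n) (Fin n) ℝ) (B : Matrix (Fin n) (Fin n) ℝ)
    (x : Fin m → ℝ) : Matrix (Fin n) (Fin n) ℝ :=
  (∑ i, x i • A i) + B

/-- `x` is strictly feasible: `∑ i, x i • A i + B` is positive definite. -/
def StrictlyFeasible {m n : ℕ} (A : Fin m → Matrix (Fin n) (Fin n) ℝ)
    (B : Matrix (Fin n) (Fin n) ℝ) (x : Fin m → ℝ) : Prop :=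
  (slack A B x).PosDef

/-- `(C_1, …, C_k)` is a regular facial reduction sequence with identity blocks of sizes
`r_1, …, r_k`: each `C_i` is symmetric, and outside its first `r_1 + ⋯ + r_{i-1}` rows and columns
(which are arbitrary) it is the block diagonal matrix `diag(I_{r_i}, 0)`. -/
def IsRegularFRSeq {n k : ℕ} (r : Fin k → ℕ) (C : Fin k → Matrix (Fin n) (Fin n) ℝ) : Prop :=
  ∑ i, r i ≤ n ∧
  ∀ i, (C i).IsSymm ∧
    ∀ p q : Fin n, ∑ l ∈ Finset.Iio i, r l ≤ (p : ℕ) → ∑ l ∈ Finset.Iio i, r l ≤ (q : ℕ) →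
      C i p q = if p = q ∧ (p : ℕ) < (∑ l ∈ Finset.Iio i, r l) + r i then 1 else 0

/-- One elementary reformulation operation on the data `(A, B)` of a semidefinite program. -/
inductive ReformStep {m n : ℕ} :
    (Fin m → Matrix (Fin n) (Fin n) ℝ) × Matrix (Fin n) (Fin n) ℝ →
    (Fin m → Matrix (Fin n) (Fin n) ℝ) × Matrix (Fin n) (Fin n) ℝ → Prop
  /-- Exchange `A i` and `A j`. -/
  | exchange (A : Fin m → Matrix (Fin n) (Fin n) ℝ) (B : Matrix (Fin n) (Fin n) ℝ)
      (i j : Fin m) (hij : i ≠ j) :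
      ReformStep (A, B) (A ∘ Equiv.swap i j, B)
  /-- Replace `A i` by `a • A i + b • A j` with `a ≠ 0`. The case `b = 0`, the scaling of `A i`,
  needs no second index. -/
  | combine (A : Fin m → Matrix (Fin n) (Fin n) ℝ) (B : Matrix (Fin n) (Fin n) ℝ)
      (i j : Fin m) (a b : ℝ) (ha : a ≠ 0) (hij : i ≠ j ∨ b = 0) :
      ReformStep (A, B) (Function.update A i (a • A i + b • A j), B)
  /-- Congruence by an invertible matrix `T`, applied to all the matrices of the program. -/
  | rotate (A : Fin m → Matrix (Fin n) (Fin n) ℝ) (B : Matrix (Fin n) (Fin n) ℝ)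
      (T : Matrix (Fin n) (Fin n) ℝ) (hT : IsUnit T) :
      ReformStep (A, B) (fun i => Tᵀ * A i * T, Tᵀ * B * T)

/-- `(A', B')` is a reformulation of `(A, B)`: it arises by finitely many elementary operations. -/
def IsReformulation {m n : ℕ} (A : Fin m → Matrix (Fin n) (Fin n) ℝ)
    (B : Matrix (Fin n) (Fin n) ℝ) (A' : Fin m → Matrix (Fin n) (Fin n) ℝ)
    (B' : Matrix (Fin n) (Fin n) ℝ) : Prop :=
  Relation.ReflTransGen ReformStep (A, B) (A', B')

/-- The ranks of the psd matrices `Y` with `trace (A i * Y) = 0` for all `i`. -/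
def dualRanks {m n : ℕ} (A : Fin m → Matrix (Fin n) (Fin n) ℝ) : Set ℕ :=
  {ρ | ∃ Y : Matrix (Fin n) (Fin n) ℝ, Y.PosSemidef ∧ (∀ i, (A i * Y).trace = 0) ∧ Y.rank = ρ}

/-- `(A', B')` is a reformulation of `(A, B)` whose first `k` matrices form a regular facial
reduction sequence, with identity blocks of sizes `r_1, …, r_k` such that `n - r_1 - ⋯ - r_k` is
the maximum rank of a psd matrix `Y` with `trace (A i * Y) = 0` for all `i`. -/
def IsRegularizedForm {m n : ℕ} (A : Fin m → Matrix (Fin n) (Fin n) ℝ)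
    (B : Matrix (Fin n) (Fin n) ℝ) (k : ℕ) (A' : Fin m → Matrix (Fin n) (Fin n) ℝ)
    (B' : Matrix (Fin n) (Fin n) ℝ) : Prop :=
  IsReformulation A B A' B' ∧
  ∃ (hk : k ≤ m) (r : Fin k → ℕ),
    IsRegularFRSeq r (fun i => A' (Fin.castLE hk i)) ∧
    IsGreatest (dualRanks A) (n - ∑ i, r i)

/-- `x` completes the tail `(x̄_{k+1}, …, x̄_m)`. Indices in `Fin m` start at `0`, so the tail is
indexed by the `i : Fin m` with `k ≤ i`. -/
def Completes {m k : ℕ} (xbar : {i : Fin m // k ≤ (i : ℕ)} → ℝ) (x : Fin m → ℝ) : Prop :=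
  ∀ i : {i : Fin m // k ≤ (i : ℕ)}, x i = xbar i

/-- The tail `(x̄_{k+1}, …, x̄_m)` has a strictly feasible completion. -/
def PartiallyStrictlyFeasible {m n k : ℕ} (A : Fin m → Matrix (Fin n) (Fin n) ℝ)
    (B : Matrix (Fin n) (Fin n) ℝ) (xbar : {i : Fin m // k ≤ (i : ℕ)} → ℝ) : Prop :=
  ∃ x : Fin m → ℝ, Completes xbar x ∧ StrictlyFeasible A B x

/-!
Strict feasibility on the blocks beyond the `i`-th one extends to the `i`-th block when `x_i` is
large, because `A_i` is the identity there and vanishes beyond it; choosing `x_k, …, x_1` one after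
the other gives the first claim.

For the second claim, minimality of `k` forces `A_{i+1}` to have a nonzero entry in the rows of
block `i` and the columns beyond block `i + 1`. Otherwise a combination of `A_i` and `A_{i+1}` is
positive definite on the union of their blocks and vanishes beyond it, so after a congruence it
replaces both in a shorter sequence. In the `2 × 2` minor of the slack matrix at this linking entry
the off-diagonal entry grows like `x_{i+1}`, one diagonal entry is `x_i + O(x_{i+1})`, and the other
is bounded by the variables after `x_{i+1}`. If these are `O(x_{i+1} ^ β)` with `β < 1`, then
positivity of the minor gives `x_{i+1} ^ (2 - β) = O(x_i)`. Starting from `β = 0` at `i + 1 = k`,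
the recursion `β ↦ 1 / (2 - β)` produces the exponents `2 - β`.
-/

section Blocks

variable {ι : Type*} [DecidableEq ι] {m k : ℕ}

/-- `M` acts as an `i`-th member of a regular facial reduction sequence when `lev p` is the
position, counted from `0`, of the identity block that contains the coordinate `p`: on the
coordinates of level at least `i` it is the diagonal indicator of level `i`. -/
structure IsFRMatrix (lev : ι → ℕ) (i : ℕ) (M : Matrix ι ι ℝ) : Prop where
  isSymm : M.IsSymm
  apply_eq : ∀ p q, i ≤ lev p → i ≤ lev q → M p q = if p = q ∧ lev p = i then 1 else 0

/-- The first `k` matrices of `A` form a regular facial reduction sequence, with the blocks given by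
`lev` instead of by their sizes; the coordinates beyond all blocks have level at least `k`. -/
def IsLevelFRSeq (k : ℕ) (lev : ι → ℕ) (A : Fin m → Matrix ι ι ℝ) : Prop :=
  ∀ i : Fin m, (i : ℕ) < k → IsFRMatrix lev i (A i)

theorem IsFRMatrix.apply_of_ne {lev : ι → ℕ} {i : ℕ} {M : Matrix ι ι ℝ} (hM : IsFRMatrix lev i M)
    {p q : ι} (hp : i ≤ lev p) (hq : i ≤ lev q) (h : p ≠ q) : M p q = 0 := by
  rw [hM.apply_eq p q hp hq, if_neg fun h' => h h'.1]

theorem IsFRMatrix.apply_of_lt_left {lev : ι → ℕ} {i : ℕ} {M : Matrix ι ι ℝ}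
    (hM : IsFRMatrix lev i M) {p q : ι} (hp : i < lev p) (hq : i ≤ lev q) : M p q = 0 := by
  rw [hM.apply_eq p q hp.le hq, if_neg fun h => hp.ne' h.2]

end Blocks

section Offsets

variable {n k : ℕ}

/-- The number of coordinates in the first `i` of the blocks of sizes `r`. -/
def blockOffset (r : Fin k → ℕ) (i : ℕ) : ℕ :=
  ∑ l ∈ Finset.univ.filter fun l : Fin k => (l : ℕ) < i, r l

theorem blockOffset_mono (r : Fin k → ℕ) : Monotone (blockOffset r) := fun _ _ h =>
  Finset.sum_le_sum_of_subset <| Finset.monotone_filter_right _ fun _ _ hl => lt_of_lt_of_le hl h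

theorem blockOffset_zero (r : Fin k → ℕ) : blockOffset r 0 = 0 := by
  simp [blockOffset]

theorem blockOffset_val (r : Fin k → ℕ) (i : Fin k) :
    blockOffset r i = ∑ l ∈ Finset.Iio i, r l := by
  rw [blockOffset]
  congr 1
  ext l
  simp

theorem blockOffset_succ (r : Fin k → ℕ) (i : Fin k) :
    blockOffset r (i + 1) = ∑ l ∈ Finset.Iio i, r l + r i := by
  rw [blockOffset, add_comm _ (r i), ← Finset.sum_insert (by simp)]
  congr 1
  ext l
  simp

theorem blockOffset_eq_sum (r : Fin k → ℕ) : blockOffset r k = ∑ l, r l := by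
  simp [blockOffset]

theorem le_findGreatest_iff_blockOffset_le (r : Fin k → ℕ) {i : ℕ} (hi : i ≤ k) (p : ℕ) :
    i ≤ Nat.findGreatest (blockOffset r · ≤ p) k ↔ blockOffset r i ≤ p := by
  refine ⟨fun h => (blockOffset_mono r h).trans ?_,
    Nat.le_findGreatest (P := (blockOffset r · ≤ p)) hi⟩
  exact Nat.findGreatest_spec (P := (blockOffset r · ≤ p)) (Nat.zero_le k)
    ((blockOffset_zero r).trans_le (Nat.zero_le p))

theorem IsRegularFRSeq.exists_isLevelFRSeq {m : ℕ} {hk : k ≤ m} {r : Fin k → ℕ}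
    {A : Fin m → Matrix (Fin n) (Fin n) ℝ} (h : IsRegularFRSeq r fun i => A (Fin.castLE hk i)) :
    ∃ lev : Fin n → ℕ, Monotone lev ∧ IsLevelFRSeq k lev A ∧
      Finset.card {p | lev p < k} = ∑ i, r i := by
  obtain ⟨hle, hblock⟩ := h
  let lev (p : Fin n) : ℕ := Nat.findGreatest (blockOffset r · ≤ p) k
  have hlev {i : ℕ} (hi : i ≤ k) (p : Fin n) : i ≤ lev p ↔ blockOffset r i ≤ p :=
    le_findGreatest_iff_blockOffset_le r hi p
  refine ⟨lev, fun p q hpq => ?_, fun i hi => ?_, ?_⟩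
  · exact Nat.findGreatest_mono_left (P := (blockOffset r · ≤ p)) (Q := (blockOffset r · ≤ q))
      (fun i hi => le_trans hi hpq) k
  · obtain ⟨hsymm, happly⟩ := hblock ⟨i, hi⟩
    refine ⟨hsymm, fun p q hp hq => ?_⟩
    have hlev_eq : lev p = i ↔ (p : ℕ) < blockOffset r (i + 1) := by
      have := hlev (i := i + 1) hi p
      have := hlev hi.le p
      omega
    rw [hlev hi.le, blockOffset_val r ⟨i, hi⟩] at hp hq
    rw [blockOffset_succ r ⟨i, hi⟩] at hlev_eq
    exact (happly p q hp hq).trans (by simp only [hlev_eq])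
  · simp only [← not_le, hlev le_rfl, blockOffset_eq_sum]
    simp only [not_le, Fin.card_filter_val_lt, min_eq_right hle]

theorem val_lt_card_iff_of_isLowerSet {s : Finset (Fin n)} (hs : IsLowerSet (s : Set (Fin n)))
    (p : Fin n) : (p : ℕ) < s.card ↔ p ∈ s := by
  refine ⟨fun h => by_contra fun hp => h.not_ge ?_, fun hp => ?_⟩
  · rw [← Fin.card_Iio p]
    exact Finset.card_le_card fun q hq => Finset.mem_Iio.2 <| lt_of_not_ge fun hpq => hp (hs hpq hq)
  · rw [← Nat.succ_le_iff, Nat.succ_eq_add_one, ← Fin.card_Iic p]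
    exact Finset.card_le_card fun q hq => hs (Finset.mem_Iic.1 hq) hp

theorem blockOffset_card_fiber (lev : Fin n → ℕ) {i : ℕ} (hi : i ≤ k) :
    blockOffset (fun l : Fin k => Finset.card {p | lev p = l}) i =
      Finset.card {p | lev p < i} := by
  induction i with
  | zero => simp [blockOffset]
  | succ i ih =>
    rw [blockOffset_succ _ ⟨i, hi⟩, ← blockOffset_val _ ⟨i, hi⟩, ih (by omega),
      ← Finset.card_union_of_disjoint (Finset.disjoint_filter.2 fun p _ h h' => h.ne h'),
      ← Finset.filter_or]
    simp only [Nat.lt_succ_iff_lt_or_eq]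

theorem IsLevelFRSeq.exists_isRegularFRSeq {m : ℕ} {lev : Fin n → ℕ}
    {A : Fin m → Matrix (Fin n) (Fin n) ℝ} (h : IsLevelFRSeq k lev A) (hlev : Monotone lev)
    (hk : k ≤ m) :
    ∃ r : Fin k → ℕ, IsRegularFRSeq r (fun i => A (Fin.castLE hk i)) ∧
      ∑ i, r i = Finset.card {p | lev p < k} := by
  let r (l : Fin k) : ℕ := Finset.card {p | lev p = l}
  have hoffset {i : ℕ} (hi : i ≤ k) (p : Fin n) : (p : ℕ) < blockOffset r i ↔ lev p < i := by
    rw [blockOffset_card_fiber lev hi, val_lt_card_iff_of_isLowerSet, Finset.mem_filter_univ]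
    intro q q' hq' hq
    simpa using (hlev hq').trans_lt (by simpa using hq)
  have hsum : ∑ i, r i = Finset.card {p | lev p < k} := by
    rw [← blockOffset_eq_sum, blockOffset_card_fiber lev le_rfl]
  refine ⟨r, ⟨hsum.trans_le (Finset.card_le_univ _ |>.trans_eq (Fintype.card_fin n)), fun i => ?_⟩,
    hsum⟩
  have hi := h (Fin.castLE hk i) i.2
  refine ⟨hi.isSymm, fun p q hp hq => ?_⟩
  rw [← blockOffset_val, ← not_lt, hoffset i.2.le, not_lt] at hp hq
  have hlev_eq : lev p = i ↔ (p : ℕ) < blockOffset r (i + 1) := by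
    rw [hoffset i.2]
    omega
  rw [← blockOffset_succ]
  exact (hi.apply_eq p q hp hq).trans (by simp only [← hlev_eq, Fin.val_castLE])

end Offsets

section Definiteness

open Filter

variable {ι : Type*}

section

variable [Fintype ι]

theorem dotProduct_add_smul_mulVec (S C : Matrix ι ι ℝ) (t : ℝ) (v : ι → ℝ) :
    v ⬝ᵥ (S + t • C) *ᵥ v = v ⬝ᵥ S *ᵥ v + t * (v ⬝ᵥ C *ᵥ v) := by
  rw [add_mulVec, smul_mulVec, dotProduct_add, dotProduct_smul, smul_eq_mul]

theorem continuous_dotProduct_mulVec (M : Matrix ι ι ℝ) :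
    Continuous fun v : ι → ℝ => v ⬝ᵥ M *ᵥ v := by
  fun_prop

theorem forall_pos_of_forall_mem_sphere {M : Matrix ι ι ℝ}
    (h : ∀ v ∈ Metric.sphere (0 : ι → ℝ) 1, 0 < v ⬝ᵥ M *ᵥ v) {v : ι → ℝ} (hv : v ≠ 0) :
    0 < v ⬝ᵥ M *ᵥ v := by
  have hnorm : 0 < ‖v‖ := norm_pos_iff.2 hv
  have hpos := h (‖v‖⁻¹ • v) (by simp [norm_smul, hnorm.ne'])
  rw [mulVec_smul, smul_dotProduct, dotProduct_smul, smul_smul, smul_eq_mul] at hpos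
  exact pos_of_mul_pos_right hpos (by positivity)

theorem eventually_posDef_add_smul {S C : Matrix ι ι ℝ} (hS : S.IsSymm) (hC : C.PosSemidef)
    (h : ∀ v : ι → ℝ, v ≠ 0 → v ⬝ᵥ C *ᵥ v = 0 → 0 < v ⬝ᵥ S *ᵥ v) :
    ∀ᶠ t : ℝ in atTop, (S + t • C).PosDef := by
  have hC_nonneg (v : ι → ℝ) : 0 ≤ v ⬝ᵥ C *ᵥ v := hC.dotProduct_mulVec_nonneg v
  have hpointwise {v : ι → ℝ} (hv : v ≠ 0) : ∃ t : ℝ, 0 < v ⬝ᵥ (S + t • C) *ᵥ v := by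
    simp only [dotProduct_add_smul_mulVec]
    rcases (hC_nonneg v).eq_or_lt with h0 | hpos
    · exact ⟨0, by simpa using h v hv h0.symm⟩
    · exact ⟨(1 - v ⬝ᵥ S *ᵥ v) / (v ⬝ᵥ C *ᵥ v), by rw [div_mul_cancel₀ _ hpos.ne']; linarith⟩
  have hsphere : ∀ᶠ t : ℝ in atTop,
      ∀ v ∈ Metric.sphere (0 : ι → ℝ) 1, 0 < v ⬝ᵥ (S + t • C) *ᵥ v := by
    refine (isCompact_sphere 0 1).induction_on (by simp)
      (fun s t hst ht => ht.mono fun _ ht v hv => ht v (hst hv))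
      (fun s t hs ht => (hs.and ht).mono fun _ h v hv => hv.elim (h.1 v) (h.2 v)) fun v hv => ?_
    obtain ⟨t, ht⟩ := hpointwise (ne_zero_of_mem_unit_sphere ⟨v, hv⟩)
    refine ⟨_, mem_nhdsWithin_of_mem_nhds
      ((continuous_dotProduct_mulVec (S + t • C)).continuousAt.eventually (lt_mem_nhds ht)), ?_⟩
    filter_upwards [eventually_ge_atTop t] with u hu w (hw : 0 < w ⬝ᵥ (S + t • C) *ᵥ w)
    rw [dotProduct_add_smul_mulVec] at hw ⊢
    exact hw.trans_le (by gcongr; exact hC_nonneg w)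
  refine hsphere.mono fun t ht => .of_dotProduct_mulVec_pos ?_ fun v hv => ?_
  · exact isHermitian_iff_isSymm.2 (hS.add ((isHermitian_iff_isSymm.1 hC.isHermitian).smul t))
  · exact forall_pos_of_forall_mem_sphere ht hv

theorem dotProduct_mulVec_eq_toSquareBlockProp (M : Matrix ι ι ℝ) {P : ι → Prop} [DecidablePred P]
    {v : ι → ℝ} (hv : ∀ p, ¬P p → v p = 0) :
    v ⬝ᵥ M *ᵥ v =
      (fun p : Subtype P => v p) ⬝ᵥ M.toSquareBlockProp P *ᵥ fun p : Subtype P => v p := by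
  have hsum (f : ι → ℝ) (hf : ∀ p, ¬P p → f p = 0) : ∑ p, f p = ∑ p : Subtype P, f p :=
    (Fintype.sum_of_injective _ Subtype.val_injective _ _ (by simpa using hf) fun _ => rfl).symm
  simp only [dotProduct, mulVec, toSquareBlockProp_def, of_apply]
  rw [hsum _ fun p hp => by rw [hv p hp, zero_mul]]
  exact Finset.sum_congr rfl fun p _ => by rw [hsum _ fun q hq => by rw [hv q hq, mul_zero]]

end

variable [Finite ι] [DecidableEq ι]

theorem eventually_posDef_add_smul_diagonal {S : Matrix ι ι ℝ} (hS : S.IsSymm) (P : ι → Prop)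
    [DecidablePred P] (h : (S.toSquareBlockProp fun p => ¬P p).PosDef) :
    ∀ᶠ t : ℝ in atTop, (S + t • diagonal fun p => if P p then (1 : ℝ) else 0).PosDef := by
  cases nonempty_fintype ι
  refine eventually_posDef_add_smul hS
    (.diagonal fun p => by simp only [Pi.zero_apply]; split_ifs <;> norm_num) fun v hv hv0 => ?_
  have hterm (p : ι) : v p * (diagonal (fun p => if P p then (1 : ℝ) else 0) *ᵥ v) p =
      if P p then v p ^ 2 else 0 := by
    rw [mulVec_diagonal]
    split_ifs <;> ring
  simp only [dotProduct, hterm] at hv0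
  rw [Finset.sum_eq_zero_iff_of_nonneg fun p _ => by positivity] at hv0
  have hsupport (p : ι) (hp : P p) : v p = 0 := by simpa [hp] using hv0 p
  rw [dotProduct_mulVec_eq_toSquareBlockProp S (P := fun p => ¬P p)
    fun p hp => hsupport p (not_not.1 hp)]
  refine h.dotProduct_mulVec_pos fun hrestrict => hv <| funext fun p => ?_
  by_cases hp : P p
  · exact hsupport p hp
  · exact congrFun hrestrict ⟨p, hp⟩

theorem IsFRMatrix.eventually_posDef_add_smul {lev : ι → ℕ} {i : ℕ} {S C : Matrix ι ι ℝ}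
    (hC : IsFRMatrix lev i C) (hS : S.IsSymm) {P : ι → Prop}
    (hP : ∀ p, P p → i ≤ lev p) (h : (S.toSquareBlockProp fun p => P p ∧ lev p ≠ i).PosDef) :
    ∀ᶠ t : ℝ in atTop, ((S + t • C).toSquareBlockProp P).PosDef := by
  have hblock : C.toSquareBlockProp P =
      diagonal fun p : Subtype P => if lev p = i then 1 else 0 := by
    ext p q
    simp only [toSquareBlockProp_def, of_apply, diagonal_apply,
      hC.apply_eq p q (hP p p.2) (hP q q.2), Subtype.ext_iff, ← ite_and]
  have hS' : (S.toSquareBlockProp P).IsSymm := hS.submatrix _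
  let incl (p : {p : Subtype P // ¬lev p = i}) : {p // P p ∧ lev p ≠ i} := ⟨p.1, p.1.2, p.2⟩
  have hincl : Function.Injective incl := fun p q hpq => by
    simpa only [incl, Subtype.ext_iff] using hpq
  have hsub : ((S.toSquareBlockProp P).toSquareBlockProp fun p => ¬lev p = i).PosDef :=
    h.submatrix hincl
  refine (eventually_posDef_add_smul_diagonal hS' _ hsub).mono fun t ht => ?_
  rw [← hblock] at ht
  exact ht

end Definiteness

section LargeFeasiblePoints

open Filter

variable {m n k : ℕ} {A : Fin m → Matrix (Fin n) (Fin n) ℝ} {B : Matrix (Fin n) (Fin n) ℝ}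

theorem slack_update (A : Fin m → Matrix (Fin n) (Fin n) ℝ) (B : Matrix (Fin n) (Fin n) ℝ)
    (x : Fin m → ℝ) (i : Fin m) (y : ℝ) :
    slack A B (Function.update x i y) = slack A B x + (y - x i) • A i := by
  have hupdate : Function.update x i y = x + Pi.single i (y - x i) := by
    rw [Function.update_eq_iff]
    simp +contextual
  simp [slack, hupdate, add_smul, Finset.sum_add_distrib, Pi.single_apply, ite_smul, add_right_comm]

theorem Completes.update {xbar : {i : Fin m // k ≤ (i : ℕ)} → ℝ} {x : Fin m → ℝ}
    (hx : Completes xbar x) {i : Fin m} (hi : (i : ℕ) < k) (y : ℝ) :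
    Completes xbar (Function.update x i y) := fun l => by
  rw [Function.update_of_ne, hx l]
  rintro rfl
  exact hi.not_ge l.2

theorem IsLevelFRSeq.exists_posDef_toSquareBlockProp {lev : Fin n → ℕ} (hA : IsLevelFRSeq k lev A)
    (hk : k ≤ m) {xbar : {i : Fin m // k ≤ (i : ℕ)} → ℝ}
    (hx : PartiallyStrictlyFeasible A B xbar) (M : ℝ) {i : ℕ} (hi : i ≤ k) :
    ∃ x : Fin m → ℝ, Completes xbar x ∧ (∀ j : Fin m, i ≤ j → (j : ℕ) < k → M ≤ x j) ∧
      (slack A B x).IsSymm ∧ ((slack A B x).toSquareBlockProp fun p => i ≤ lev p).PosDef := by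
  induction hi using Nat.decreasingInduction with
  | self =>
    obtain ⟨x, hcompl, hpos⟩ := hx
    exact ⟨x, hcompl, fun j hkj hjk => absurd hjk hkj.not_gt, isHermitian_iff_isSymm.1 hpos.1,
      hpos.submatrix Subtype.val_injective⟩
  | of_succ i hik ih =>
    obtain ⟨x, hcompl, hlarge, hsymm, hpos⟩ := ih
    let i' : Fin m := ⟨i, hik.trans_le hk⟩
    have hblock : ((slack A B x).toSquareBlockProp fun p => i ≤ lev p ∧ lev p ≠ i).PosDef := by
      convert hpos using 5
      all_goals omega
    obtain ⟨t, ht, hMt⟩ := (((hA i' hik).eventually_posDef_add_smul hsymm (fun _ hp => hp)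
      hblock).and (eventually_ge_atTop (M - x i'))).exists
    refine ⟨Function.update x i' (x i' + t), hcompl.update hik _, fun j hij hjk => ?_, ?_, ?_⟩
    · rcases eq_or_ne j i' with rfl | hne
      · simpa [add_comm] using hMt
      · rw [Function.update_of_ne hne]
        exact hlarge j (hij.lt_of_ne fun h => hne (Fin.ext h.symm)) hjk
    · rw [slack_update]
      exact hsymm.add ((hA i' hik).isSymm.smul _)
    · rwa [slack_update, add_sub_cancel_left]

theorem IsLevelFRSeq.exists_strictlyFeasible_ge {lev : Fin n → ℕ} (hA : IsLevelFRSeq k lev A)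
    (hk : k ≤ m) {xbar : {i : Fin m // k ≤ (i : ℕ)} → ℝ}
    (hx : PartiallyStrictlyFeasible A B xbar) (M : ℝ) :
    ∃ x : Fin m → ℝ, Completes xbar x ∧ StrictlyFeasible A B x ∧
      ∀ i : Fin m, (i : ℕ) < k → M ≤ x i := by
  obtain ⟨x, hcompl, hlarge, -, hpos⟩ :=
    hA.exists_posDef_toSquareBlockProp hk hx M (Nat.zero_le k)
  refine ⟨x, hcompl, ?_, fun i hi => hlarge i (Nat.zero_le _) hi⟩
  exact hpos.submatrix (e := fun p => ⟨p, Nat.zero_le _⟩) fun p q hpq => congrArg Subtype.val hpq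

end LargeFeasiblePoints

section Congruence

variable {ι : Type*} {P : ι → Prop} {C M T : Matrix ι ι ℝ}

section

variable [Fintype ι]

theorem transpose_mul_mul_apply (M T : Matrix ι ι ℝ) (p q : ι) :
    (Tᵀ * M * T) p q = ∑ b, ∑ a, T a p * M a b * T b q := by
  simp only [mul_apply, transpose_apply, Finset.sum_mul]

theorem transpose_mul_mul_apply_eq_zero {p q : ι}
    (h : ∀ a b, T a p ≠ 0 → T b q ≠ 0 → M a b = 0) : (Tᵀ * M * T) p q = 0 := by
  rw [transpose_mul_mul_apply]
  refine Finset.sum_eq_zero fun b _ => Finset.sum_eq_zero fun a _ => ?_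
  by_cases ha : T a p = 0
  · rw [ha, zero_mul, zero_mul]
  by_cases hb : T b q = 0
  · rw [hb, mul_zero]
  · rw [h a b ha hb, mul_zero, zero_mul]

theorem isSymm_transpose_mul_mul (hM : M.IsSymm) (T : Matrix ι ι ℝ) : (Tᵀ * M * T).IsSymm := by
  rw [IsSymm, transpose_mul, transpose_mul, transpose_transpose, hM.eq, Matrix.mul_assoc]

end

variable [DecidableEq ι]

/-- `T` only acts on the coordinates satisfying `P`: all its other rows and columns are those of
the identity matrix. -/
def IsIdentityOff (P : ι → Prop) (T : Matrix ι ι ℝ) : Prop :=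
  ∀ a p, ¬(P a ∧ P p) → T a p = (1 : Matrix ι ι ℝ) a p

theorem IsIdentityOff.eq_or_and_of_apply_ne_zero (hT : IsIdentityOff P T) {a p : ι}
    (h : T a p ≠ 0) : a = p ∨ P a ∧ P p := by
  refine or_iff_not_imp_right.2 fun hP => by_contra fun hne => h ?_
  rw [hT a p hP, one_apply_ne hne]

variable [Fintype ι]

theorem IsIdentityOff.transpose_mul_mul_apply (hT : IsIdentityOff P T) {p q : ι} (hp : ¬P p)
    (hq : ¬P q) : (Tᵀ * M * T) p q = M p q := by
  have hcol {r : ι} (hr : ¬P r) (a : ι) : T a r = (1 : Matrix ι ι ℝ) a r :=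
    hT a r fun h => hr h.2
  simp [_root_.transpose_mul_mul_apply, hcol hp, hcol hq, one_apply]

open scoped MatrixOrder in
theorem exists_isUnit_transpose_mul_mul_eq_one (hC : C.PosDef) :
    ∃ T : Matrix ι ι ℝ, IsUnit T ∧ Tᵀ * C * T = 1 := by
  obtain ⟨L, hL, rfl⟩ := CStarAlgebra.isStrictlyPositive_iff_eq_star_mul_self.1
    (isStrictlyPositive_iff_posDef.2 hC)
  have hdet : IsUnit L.det := (isUnit_iff_isUnit_det L).1 hL
  refine ⟨L⁻¹, isUnit_nonsing_inv_iff.2 hL, ?_⟩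
  rw [star_eq_conjTranspose, conjTranspose_eq_transpose_of_trivial, ← mul_assoc, ← transpose_mul,
    mul_nonsing_inv _ hdet, transpose_one, one_mul, mul_nonsing_inv _ hdet]

theorem exists_isIdentityOff_transpose_mul_mul_apply
    (hC : (C.toSquareBlockProp P).PosDef) :
    ∃ T : Matrix ι ι ℝ, IsUnit T ∧ IsIdentityOff P T ∧
      ∀ p q, P p → P q → (Tᵀ * C * T) p q = (1 : Matrix ι ι ℝ) p q := by
  classical
  obtain ⟨T₀, hunit, hT₀⟩ := exists_isUnit_transpose_mul_mul_eq_one hC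
  let e : ι ≃ Subtype P ⊕ {p // ¬P p} := (Equiv.sumCompl P).symm
  have he (p : ι) (hp : P p) : e p = .inl ⟨p, hp⟩ := Equiv.sumCompl_symm_apply_of_pos hp
  have he' (p : ι) (hp : ¬P p) : e p = .inr ⟨p, hp⟩ := Equiv.sumCompl_symm_apply_of_neg hp
  refine ⟨(fromBlocks T₀ 0 0 1).submatrix e e, ?_, fun a p hap => ?_, fun p q hp hq => ?_⟩
  · rw [isUnit_submatrix_equiv, isUnit_iff_isUnit_det, det_fromBlocks_zero₂₁, det_one, mul_one]
    exact (isUnit_iff_isUnit_det _).1 hunit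
  · by_cases ha : P a <;> by_cases hp : P p
    · exact absurd ⟨ha, hp⟩ hap
    · simp [he a ha, he' p hp, one_apply_ne (ne_of_mem_of_not_mem (s := {p | P p}) ha hp)]
    · simp [he' a ha, he p hp, one_apply_ne (ne_of_mem_of_not_mem (s := {p | P p}) hp ha).symm]
    · simp [he' a ha, he' p hp, one_apply]
  · have hblock : (C.submatrix e.symm e.symm).toBlocks₁₁ = C.toSquareBlockProp P := rfl
    have hCe : C = (C.submatrix e.symm e.symm).submatrix e e := by simp
    rw [hCe, transpose_submatrix, submatrix_mul_equiv, submatrix_mul_equiv,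
      ← fromBlocks_toBlocks (C.submatrix e.symm e.symm), fromBlocks_transpose, fromBlocks_multiply,
      fromBlocks_multiply, submatrix_apply, he p hp, he q hq, fromBlocks_apply₁₁, hblock]
    simp [hT₀, one_apply]

variable {lev : ι → ℕ} {i j : ℕ}

theorem IsFRMatrix.transpose_mul_mul (hM : IsFRMatrix lev j M)
    (hT : IsIdentityOff (fun p => lev p = i) T) (hij : j ≠ i) :
    IsFRMatrix lev j (Tᵀ * M * T) := by
  have hsymm := isSymm_transpose_mul_mul hM.isSymm T
  have hzero {p q : ι} (hp : lev p = i) (hjp : j ≤ lev p) (hq : j ≤ lev q) :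
      (Tᵀ * M * T) p q = 0 := by
    refine transpose_mul_mul_apply_eq_zero fun a b ha hb => hM.apply_of_lt_left ?_ ?_
    · rcases hT.eq_or_and_of_apply_ne_zero ha with rfl | ⟨ha, -⟩ <;> omega
    · rcases hT.eq_or_and_of_apply_ne_zero hb with rfl | ⟨hb, -⟩ <;> omega
  refine ⟨hsymm, fun p q hp hq => ?_⟩
  by_cases hpi : lev p = i
  · rw [hzero hpi hp hq, if_neg (by omega)]
  by_cases hqi : lev q = i
  · rw [← hsymm.apply, hzero hqi hq hp, if_neg (by rintro ⟨rfl, -⟩; exact hpi hqi)]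
  · rw [hT.transpose_mul_mul_apply hpi hqi, hM.apply_eq p q hp hq]

theorem isFRMatrix_transpose_mul_mul (hC : C.IsSymm)
    (hzero : ∀ p q, i < lev p → i ≤ lev q → C p q = 0)
    (hT : IsIdentityOff (fun p => lev p = i) T)
    (hone : ∀ p q, lev p = i → lev q = i → (Tᵀ * C * T) p q = (1 : Matrix ι ι ℝ) p q) :
    IsFRMatrix lev i (Tᵀ * C * T) := by
  have hsymm := isSymm_transpose_mul_mul hC T
  have hzero' {p q : ι} (hp : i < lev p) (hq : i ≤ lev q) : (Tᵀ * C * T) p q = 0 := by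
    refine transpose_mul_mul_apply_eq_zero fun a b ha hb => hzero a b ?_ ?_
    · rcases hT.eq_or_and_of_apply_ne_zero ha with rfl | ⟨-, hp'⟩ <;> omega
    · rcases hT.eq_or_and_of_apply_ne_zero hb with rfl | ⟨hb, -⟩ <;> omega
  refine ⟨hsymm, fun p q hp hq => ?_⟩
  rcases hp.eq_or_lt with hp' | hp'
  · rcases hq.eq_or_lt with hq' | hq'
    · simp only [hone p q hp'.symm hq'.symm, one_apply, hp'.symm, and_true]
    · rw [← hsymm.apply, hzero' hq' hp, if_neg (by rintro ⟨rfl, -⟩; omega)]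
  · rw [hzero' hp' hq, if_neg (by omega)]

end Congruence

section Merging

theorem IsFRMatrix.relabel {ι : Type*} [DecidableEq ι] {lev lev' : ι → ℕ} {i i' : ℕ}
    {M : Matrix ι ι ℝ} (hM : IsFRMatrix lev i M) (hle : ∀ p, i' ≤ lev' p → i ≤ lev p)
    (heq : ∀ p, lev' p = i' ↔ lev p = i) : IsFRMatrix lev' i' M :=
  ⟨hM.isSymm, fun p q hp hq => by simp only [hM.apply_eq p q (hle p hp) (hle q hq), heq]⟩

variable {m n : ℕ} {A : Fin m → Matrix (Fin n) (Fin n) ℝ}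

theorem isReformulation_comp_perm (A : Fin m → Matrix (Fin n) (Fin n) ℝ)
    (B : Matrix (Fin n) (Fin n) ℝ) (σ : Equiv.Perm (Fin m)) :
    IsReformulation A B (A ∘ σ) B := by
  induction σ using Equiv.Perm.swap_induction_on' with
  | one => exact Relation.ReflTransGen.refl
  | mul_swap f x y hxy ih => exact ih.tail (ReformStep.exchange (A ∘ f) B x y hxy)

theorem exists_isReformulation_contract (A : Fin m → Matrix (Fin n) (Fin n) ℝ)
    (B : Matrix (Fin n) (Fin n) ℝ) {i₀ i₁ : Fin m} (hi : (i₁ : ℕ) = i₀ + 1) (c : ℝ) :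
    ∃ A', IsReformulation A B A' B ∧ (∀ i < i₀, A' i = A i) ∧ A' i₀ = A i₁ + c • A i₀ ∧
      ∀ i j : Fin m, i₀ < i → (j : ℕ) = i + 1 → A' i = A j := by
  have : NeZero m := ⟨i₀.pos.ne'⟩
  have hne : i₁ ≠ i₀ := fun h => by omega
  let A₁ := Function.update A i₁ ((1 : ℝ) • A i₁ + c • A i₀)
  have hA₁ {j : Fin m} (hj : j ≠ i₁) : A₁ j = A j := Function.update_of_ne hj _ _
  have hcombine : IsReformulation A B A₁ B :=
    .single (.combine A B i₁ i₀ 1 c one_ne_zero (.inl hne))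
  let σ := Fin.cycleIcc i₀ ⊤
  have hσ {i j : Fin m} (hi : i₀ ≤ i) (hj : (j : ℕ) = i + 1) : σ i = j := by
    have hlt : i < j := Fin.lt_def.2 (by omega)
    rw [Fin.cycleIcc_of_ge_of_lt hi (hlt.trans_le le_top)]
    exact Fin.ext (by rw [hj, Fin.val_add_one_of_lt' (by omega)])
  refine ⟨A₁ ∘ σ, hcombine.trans (isReformulation_comp_perm A₁ B σ), fun i hlt => ?_, ?_,
    fun i j hlt hj => ?_⟩
  · rw [Function.comp_apply, Fin.cycleIcc_of_lt hlt]
    exact hA₁ (fun h => by omega)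
  · rw [Function.comp_apply, hσ le_rfl hi]
    simp only [A₁, Function.update_self, one_smul]
  · rw [Function.comp_apply, hσ hlt.le hj]
    exact hA₁ (fun h => by omega)

theorem exists_isReformulation_isLevelFRSeq {k : ℕ} {lev : Fin n → ℕ} (i : Fin m)
    (hA : ∀ j : Fin m, (j : ℕ) < k → j ≠ i → IsFRMatrix lev j (A j))
    (hsymm : (A i).IsSymm) (hzero : ∀ p q, i < lev p → i ≤ lev q → A i p q = 0)
    (hpos : ((A i).toSquareBlockProp fun p => lev p = i).PosDef) (B : Matrix (Fin n) (Fin n) ℝ) :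
    ∃ A' B', IsReformulation A B A' B' ∧ IsLevelFRSeq k lev A' := by
  obtain ⟨T, hunit, hT, hone⟩ := exists_isIdentityOff_transpose_mul_mul_apply hpos
  refine ⟨fun j => Tᵀ * A j * T, Tᵀ * B * T, .single (.rotate A B T hunit), fun j hj => ?_⟩
  rcases eq_or_ne j i with rfl | hne
  · exact isFRMatrix_transpose_mul_mul hsymm hzero hT hone
  · exact (hA j hj hne).transpose_mul_mul hT (Fin.val_ne_of_ne hne)

/-- The levels after the blocks `i` and `i + 1` have been merged into one. -/
def mergeLevel {ι : Type*} (i : ℕ) (lev : ι → ℕ) (p : ι) : ℕ :=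
  if lev p ≤ i then lev p else lev p - 1

theorem IsFRMatrix.exists_posDef_mergeLevel {ι : Type*} [Finite ι] [DecidableEq ι] {lev : ι → ℕ}
    {i : ℕ} {M N : Matrix ι ι ℝ} (hM : IsFRMatrix lev i M) (hN : IsFRMatrix lev (i + 1) N) :
    ∃ c : ℝ, ((N + c • M).toSquareBlockProp fun p => mergeLevel i lev p = i).PosDef := by
  have hlev {p : ι} (hp : mergeLevel i lev p = i) : lev p = i ∨ lev p = i + 1 := by
    unfold mergeLevel at hp
    split_ifs at hp <;> omega
  have hone : N.toSquareBlockProp (fun p => mergeLevel i lev p = i ∧ lev p ≠ i) = 1 := by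
    ext ⟨p, hp, hp'⟩ ⟨q, hq, hq'⟩
    replace hp := (hlev hp).resolve_left hp'
    replace hq := (hlev hq).resolve_left hq'
    simp [toSquareBlockProp_def, hN.apply_eq p q hp.ge hq.ge, hp, one_apply]
  exact (hM.eventually_posDef_add_smul hN.isSymm (fun p hp => by have := hlev hp; omega)
    (hone ▸ PosDef.one)).exists

theorem IsLevelFRSeq.exists_merge {k : ℕ} {lev : Fin n → ℕ} (hA : IsLevelFRSeq (k + 1) lev A)
    (hk : k + 1 ≤ m) {i₀ i₁ : Fin m} (hi : (i₁ : ℕ) = i₀ + 1) (hik : (i₁ : ℕ) < k + 1)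
    (hzero : ∀ p q, lev p = i₀ → i₁ < lev q → A i₁ p q = 0) (B : Matrix (Fin n) (Fin n) ℝ) :
    ∃ A' B', IsReformulation A B A' B' ∧ IsLevelFRSeq k (mergeLevel i₀ lev) A' := by
  have h₀ := hA i₀ (by omega)
  have h₁ := hA i₁ hik
  obtain ⟨c, hc⟩ := h₀.exists_posDef_mergeLevel (hi ▸ h₁)
  obtain ⟨A', href, hlt, heq, hgt⟩ := exists_isReformulation_contract A B hi c
  have hother (j : Fin m) (hjk : (j : ℕ) < k) (hj : j ≠ i₀) :
      IsFRMatrix (mergeLevel i₀ lev) j (A' j) := by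
    rcases hj.lt_or_gt with hj | hj
    · rw [hlt j hj]
      refine (hA j (by omega)).relabel (fun p => ?_) fun p => ?_ <;>
        unfold mergeLevel <;> split_ifs <;> omega
    · rw [hgt j ⟨j + 1, by omega⟩ hj rfl]
      refine (hA ⟨j + 1, by omega⟩ (by simpa using hjk)).relabel (fun p => ?_) fun p => ?_ <;>
        simp only [mergeLevel] <;> split_ifs <;> omega
  have hmerged (p q : Fin n) (hp : i₀ < mergeLevel i₀ lev p) (hq : i₀ ≤ mergeLevel i₀ lev q) :
      (A i₁ + c • A i₀) p q = 0 := by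
    have hp' : i₁ < lev p := by unfold mergeLevel at hp; split_ifs at hp <;> omega
    have hq' : i₀ ≤ lev q := by unfold mergeLevel at hq; split_ifs at hq <;> omega
    have hz₁ : A i₁ p q = 0 := by
      rcases hq'.eq_or_lt with hq' | hq'
      · rw [← h₁.isSymm.apply, hzero q p hq'.symm hp']
      · exact h₁.apply_of_lt_left hp' (by omega)
    rw [Matrix.add_apply, Matrix.smul_apply, hz₁, h₀.apply_of_lt_left (by omega) hq', smul_zero,
      add_zero]
  obtain ⟨A'', B'', href', hA''⟩ := exists_isReformulation_isLevelFRSeq i₀ hother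
    (heq ▸ h₁.isSymm.add (h₀.isSymm.smul c)) (heq ▸ hmerged) (heq ▸ hc) B
  exact ⟨A'', B'', href.trans href', hA''⟩

theorem monotone_mergeLevel {ι : Type*} [Preorder ι] (i : ℕ) {lev : ι → ℕ} (hlev : Monotone lev) :
    Monotone (mergeLevel i lev) := fun p q hpq => by
  have := hlev hpq
  unfold mergeLevel
  split_ifs <;> omega

theorem mergeLevel_lt_iff {ι : Type*} {i k : ℕ} (hik : i < k) (lev : ι → ℕ) (p : ι) :
    mergeLevel i lev p < k ↔ lev p < k + 1 := by
  unfold mergeLevel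
  split_ifs <;> omega

/-- Each matrix of the sequence after the first has a nonzero entry in the rows of the preceding
block and beyond the columns of its own block. -/
def IsLinked (k : ℕ) (lev : Fin n → ℕ) (A : Fin m → Matrix (Fin n) (Fin n) ℝ) : Prop :=
  ∀ i j : Fin m, (j : ℕ) = i + 1 → (j : ℕ) < k → ∃ p q, lev p = i ∧ j < lev q ∧ A j p q ≠ 0

theorem IsLevelFRSeq.isLinked_of_minimal {k : ℕ} {lev : Fin n → ℕ} {B : Matrix (Fin n) (Fin n) ℝ}
    (hA : IsLevelFRSeq k lev A) (hlev : Monotone lev) (hk : k ≤ m)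
    (hmin : ∀ (k' : ℕ) (A' : Fin m → Matrix (Fin n) (Fin n) ℝ) (B' : Matrix (Fin n) (Fin n) ℝ)
      (hk' : k' ≤ m) (r : Fin k' → ℕ), IsReformulation A B A' B' →
      IsRegularFRSeq r (fun i => A' (Fin.castLE hk' i)) →
      ∑ i, r i = Finset.card {p | lev p < k} → k ≤ k') :
    IsLinked k lev A := by
  intro i j hij hjk
  by_contra! hcon
  obtain ⟨k, rfl⟩ : ∃ k', k = k' + 1 := ⟨k - 1, by omega⟩
  obtain ⟨A', B', href, hA'⟩ := hA.exists_merge hk hij hjk hcon B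
  obtain ⟨r, hr, hsum⟩ := hA'.exists_isRegularFRSeq (monotone_mergeLevel i hlev) (by omega)
  simp only [mergeLevel_lt_iff (show (i : ℕ) < k by omega)] at hsum
  exact absurd (hmin k A' B' _ r href hr hsum) (by omega)

end Merging

section Growth

open Filter Asymptotics

theorem rpow_isBigO_iff {α : Type*} {l : Filter α} {f g : α → ℝ} {r : ℝ} (hr : 0 < r)
    (hf : 0 ≤ᶠ[l] f) (hg : 0 ≤ᶠ[l] g) :
    (fun x => f x ^ r) =O[l] g ↔ f =O[l] fun x => g x ^ r⁻¹ := by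
  refine ⟨fun h => (h.rpow (inv_nonneg.2 hr.le) hg).congr' ?_ .rfl,
    fun h => (h.rpow hr.le ?_).congr' .rfl ?_⟩
  · filter_upwards [hf] with x hx using Real.rpow_rpow_inv hx hr.ne'
  · filter_upwards [hg] with x hx using Real.rpow_nonneg hx _
  · filter_upwards [hg] with x hx using Real.rpow_inv_rpow hx hr.ne'

theorem rpow_isLittleO_rpow {α : Type*} {l : Filter α} {g : α → ℝ} {r s : ℝ} (hrs : r < s)
    (hg : Tendsto g l atTop) : (fun x => g x ^ r) =o[l] fun x => g x ^ s := by
  refine .of_tendsto_div_atTop (((tendsto_rpow_atTop (sub_pos.2 hrs)).comp hg).congr' ?_)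
  filter_upwards [hg.eventually_gt_atTop 0] with x hx using Real.rpow_sub hx s r

theorem tendsto_atTop_and_isBigO_rpow_of_sq_isBigO_mul {α : Type*} {l : Filter α} {f g h u : α → ℝ}
    {β : ℝ} (hβ : β < 1) (hg : Tendsto g l atTop) (hf : 0 ≤ᶠ[l] f)
    (hh : h =O[l] fun x => g x ^ β) (hsq : (fun x => g x ^ 2) =O[l] fun x => f x * h x)
    (hfu : (fun x => f x - u x) =O[l] g) :
    Tendsto u l atTop ∧ g =O[l] fun x => u x ^ (2 - β)⁻¹ := by
  have hgf : (fun x => g x ^ (2 - β)) =O[l] f := by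
    have hmul := (hsq.trans ((isBigO_refl f l).mul hh)).mul (isBigO_refl (fun x => g x ^ (-β)) l)
    refine hmul.congr' ?_ ?_ <;> filter_upwards [hg.eventually_gt_atTop 0] with x hx
    · rw [← Real.rpow_two, ← Real.rpow_add hx, sub_eq_add_neg]
    · rw [mul_assoc, ← Real.rpow_add hx, add_neg_cancel, Real.rpow_zero, mul_one]
  have hlittle : g =o[l] f := by
    simpa only [Real.rpow_one] using
      (rpow_isLittleO_rpow (show 1 < 2 - β by linarith) hg).trans_isBigO hgf
  have hequiv : f ~[l] u := IsEquivalent.symm (hfu.trans_isLittleO hlittle).symm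
  have hf_lim : Tendsto f l atTop :=
    (hlittle.isBigO.trans_tendsto_norm_atTop (tendsto_norm_atTop_atTop.comp hg)).congr'
      (hf.mono fun x hx => Real.norm_of_nonneg hx)
  have hu_lim : Tendsto u l atTop := hequiv.tendsto_atTop hf_lim
  exact ⟨hu_lim, (rpow_isBigO_iff (by linarith) (hg.eventually_ge_atTop 0)
    (hu_lim.eventually_ge_atTop 0)).1 (hgf.trans hequiv.isBigO)⟩

theorem sq_apply_lt_mul_of_posDef {ι : Type*} {S : Matrix ι ι ℝ} (hS : S.PosDef) {p q : ι}
    (hpq : p ≠ q) : S p q ^ 2 < S p p * S q q := by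
  have hinj : Function.Injective ![p, q] := by
    intro a b
    fin_cases a <;> fin_cases b <;> simp [hpq, hpq.symm]
  have hdet := (hS.submatrix hinj).det_pos
  rw [det_fin_two] at hdet
  have hsymm : S q p = S p q := (isHermitian_iff_isSymm.1 hS.isHermitian).apply p q
  simp only [submatrix_apply, cons_val_zero, cons_val_one, hsymm] at hdet
  linarith [sq (S p q)]

variable {m n k : ℕ} {l : Filter (Fin m → ℝ)} {A : Fin m → Matrix (Fin n) (Fin n) ℝ}
  {B : Matrix (Fin n) (Fin n) ℝ}

theorem slack_apply_sub_isBigO {h : (Fin m → ℝ) → ℝ} {j : Fin m} {p q : Fin n}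
    (hone : (fun _ => (1 : ℝ)) =O[l] h) (hzero : ∀ i < j, A i p q = 0)
    (hlarge : ∀ i, j < i → (fun x => x i) =O[l] h) :
    (fun x => slack A B x p q - x j * A j p q) =O[l] h := by
  have hsplit : (fun x => slack A B x p q - x j * A j p q) =
      fun x => (∑ i ∈ Finset.univ.erase j, A i p q * x i) + B p q * 1 := by
    funext x
    simp only [slack, Matrix.add_apply, Matrix.sum_apply, Matrix.smul_apply, smul_eq_mul,
      ← Finset.add_sum_erase _ _ (Finset.mem_univ j), mul_comm (x _)]
    ring
  rw [hsplit]
  refine (IsBigO.fun_sum fun i hi => ?_).add (hone.const_mul_left _)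
  rcases lt_or_gt_of_ne (Finset.ne_of_mem_erase hi) with hlt | hgt
  · simp only [hzero i hlt, zero_mul]
    exact isBigO_zero _ _
  · exact (hlarge i hgt).const_mul_left _

theorem isBigO_slack_apply {h : (Fin m → ℝ) → ℝ} {j : Fin m} {p q : Fin n}
    (hone : (fun _ => (1 : ℝ)) =O[l] h) (hzero : ∀ i < j, A i p q = 0)
    (hlarge : ∀ i, j < i → (fun x => x i) =O[l] h) (hlittle : h =o[l] fun x => x j)
    (hpq : A j p q ≠ 0) : (fun x => x j) =O[l] fun x => slack A B x p q := by
  have hscale : (fun x => x j) =O[l] fun x => x j * A j p q :=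
    (isBigO_self_const_mul hpq _ l).congr_right fun x => mul_comm _ _
  have hequiv : (fun x => slack A B x p q) ~[l] fun x => x j * A j p q :=
    ((slack_apply_sub_isBigO hone hzero hlarge).trans_isLittleO hlittle).trans_isBigO hscale
  exact hscale.trans hequiv.isBigO_symm

/-- Along `l`, the `i`-th variable tends to infinity and its power of exponent `β` dominates all
later variables. -/
structure DominatesLater (l : Filter (Fin m → ℝ)) (β : ℝ) (i : Fin m) : Prop where
  tendsto : Tendsto (fun x => x i) l atTop
  isBigO : ∀ j, i < j → (fun x => x j) =O[l] fun x => x i ^ β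

theorem DominatesLater.one_isBigO {β : ℝ} {i : Fin m} (h : DominatesLater l β i) (hβ : 0 ≤ β) :
    (fun _ => (1 : ℝ)) =O[l] fun x => x i ^ β := by
  refine .of_bound' ?_
  filter_upwards [h.tendsto.eventually_ge_atTop 1] with x hx
  simpa using (Real.one_le_rpow hx hβ).trans (le_abs_self _)

theorem DominatesLater.of_linked {lev : Fin n → ℕ} {β : ℝ} {i₀ i₁ : Fin m} {p q : Fin n}
    (h : DominatesLater l β i₁) (hβ₀ : 0 ≤ β) (hβ₁ : β < 1)
    (hfeas : ∀ᶠ x in l, StrictlyFeasible A B x) (hA : ∀ i ≤ i₁, IsFRMatrix lev i (A i))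
    (hi : (i₁ : ℕ) = i₀ + 1) (hp : lev p = i₀) (hq : i₁ < lev q) (hpq : A i₁ p q ≠ 0) :
    DominatesLater l (2 - β)⁻¹ i₀ := by
  have hne : p ≠ q := by
    rintro rfl
    omega
  have hlittle : (fun x => x i₁ ^ β) =o[l] fun x => x i₁ := by
    simpa only [Real.rpow_one] using rpow_isLittleO_rpow hβ₁ h.tendsto
  have hlater : ∀ j, i₀ < j → (fun x => x j) =O[l] fun x => x i₁ := fun j hj => by
    rcases (show i₁ ≤ j from Fin.le_def.2 (by omega)).eq_or_lt with rfl | hj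
    · exact isBigO_refl _ _
    · exact (h.isBigO j hj).trans hlittle.isBigO
  have hone := h.one_isBigO hβ₀
  have hSpp : (fun x => slack A B x p p - x i₀) =O[l] fun x => x i₁ := by
    have hApp : A i₀ p p = 1 := by simp [(hA i₀ (by omega)).apply_eq p p hp.ge hp.ge, hp]
    simpa only [hApp, mul_one] using slack_apply_sub_isBigO (hone.trans hlittle.isBigO)
      (fun i hi => (hA i (by omega)).apply_of_lt_left (p := p) (q := p) (by omega) (by omega))
      hlater
  have hSqq : (fun x => slack A B x q q) =O[l] fun x => x i₁ ^ β := by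
    have hAqq : ∀ i ≤ i₁, A i q q = 0 := fun i hi =>
      (hA i hi).apply_of_lt_left (by omega) (by omega)
    simpa only [hAqq i₁ le_rfl, mul_zero, sub_zero] using
      slack_apply_sub_isBigO hone (fun i hi => hAqq i hi.le) h.isBigO
  have hSpq : (fun x => x i₁) =O[l] fun x => slack A B x p q :=
    isBigO_slack_apply hone (fun i hi => (hA i hi.le).apply_of_ne (by omega) (by omega) hne)
      h.isBigO hlittle hpq
  have hminor : (fun x => x i₁ ^ 2) =O[l] fun x => slack A B x p p * slack A B x q q := by
    refine (hSpq.pow 2).trans (.of_bound' ?_)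
    filter_upwards [hfeas] with x hx
    rw [Real.norm_of_nonneg (sq_nonneg _)]
    exact (sq_apply_lt_mul_of_posDef hx hne).le.trans (le_abs_self _)
  obtain ⟨hlim, hO⟩ := tendsto_atTop_and_isBigO_rpow_of_sq_isBigO_mul hβ₁ h.tendsto
    (hfeas.mono fun x hx => (PosDef.diag_pos (A := slack A B x) hx).le) hSqq hminor hSpp
  exact ⟨hlim, fun j hj => (hlater j hj).trans hO⟩

/-- The strictly feasible completions of a tail with `k ≤ i`, as the variable of index `k - 1` tends
to infinity (all such completions, if `k = 0`). -/
def feasibleAtTop (A : Fin m → Matrix (Fin n) (Fin n) ℝ) (B : Matrix (Fin n) (Fin n) ℝ)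
    (xbar : {i : Fin m // k ≤ (i : ℕ)} → ℝ) : Filter (Fin m → ℝ) :=
  ⨅ K : ℝ, 𝓟 {x | Completes xbar x ∧ StrictlyFeasible A B x ∧
    ∀ i : Fin m, (i : ℕ) + 1 = k → K ≤ x i}

theorem eventually_feasibleAtTop {xbar : {i : Fin m // k ≤ (i : ℕ)} → ℝ} {P : (Fin m → ℝ) → Prop} :
    (∀ᶠ x in feasibleAtTop A B xbar, P x) ↔
      ∃ K : ℝ, ∀ x, Completes xbar x → StrictlyFeasible A B x →
        (∀ i : Fin m, (i : ℕ) + 1 = k → K ≤ x i) → P x := by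
  have hanti : Antitone fun K : ℝ => 𝓟 {x : Fin m → ℝ | Completes xbar x ∧ StrictlyFeasible A B x ∧
      ∀ i : Fin m, (i : ℕ) + 1 = k → K ≤ x i} := fun K L hKL =>
    principal_mono.2 fun x hx => ⟨hx.1, hx.2.1, fun i hi => hKL.trans (hx.2.2 i hi)⟩
  rw [feasibleAtTop, Filter.Eventually, mem_iInf_of_directed hanti.directed_ge]
  simp only [mem_principal, Set.ofPred_subset_ofPred, and_imp]

theorem dominatesLater_last (xbar : {i : Fin m // k ≤ (i : ℕ)} → ℝ) {i : Fin m}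
    (hi : (i : ℕ) + 1 = k) : DominatesLater (feasibleAtTop A B xbar) 0 i where
  tendsto := tendsto_atTop.2 fun K =>
    eventually_feasibleAtTop.2 ⟨K, fun x _ _ hx => hx i hi⟩
  isBigO j hj := by
    have hjk : k ≤ j := by omega
    simp only [Real.rpow_zero]
    refine (isBigO_const_const (xbar ⟨j, hjk⟩) one_ne_zero _).congr' ?_ .rfl
    exact eventually_feasibleAtTop.2 ⟨0, fun x hx _ _ => (hx ⟨j, hjk⟩).symm⟩

theorem inv_two_sub_one_sub_one_div {t : ℝ} (ht : 0 < t) :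
    (2 - (1 - 1 / t))⁻¹ = 1 - 1 / (t + 1) := by
  rw [show 2 - (1 - 1 / t) = (t + 1) / t by field_simp; ring, inv_div]
  field_simp
  ring

theorem IsLinked.dominatesLater {lev : Fin n → ℕ} (hlink : IsLinked k lev A) (hk : k ≤ m)
    (hA : IsLevelFRSeq k lev A) (xbar : {i : Fin m // k ≤ (i : ℕ)} → ℝ) (i : Fin m)
    (hi : (i : ℕ) < k) :
    DominatesLater (feasibleAtTop A B xbar) (1 - 1 / ((k : ℝ) - (i : ℕ))) i := by
  obtain ⟨t, ht⟩ : ∃ t, k = (i : ℕ) + 1 + t := Nat.exists_eq_add_of_le hi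
  induction t generalizing i with
  | zero => simpa [ht] using dominatesLater_last (A := A) (B := B) xbar ht.symm
  | succ t ih =>
    let i₁ : Fin m := ⟨i + 1, by omega⟩
    have hi₁ : (i₁ : ℕ) < k := show (i : ℕ) + 1 < k by omega
    have hgap : (k : ℝ) - (i₁ : ℕ) = t + 1 := by simp only [i₁, ht]; push_cast; ring
    have hgap' : (k : ℝ) - (i : ℕ) = t + 1 + 1 := by rw [ht]; push_cast; ring
    have hdom := ih i₁ hi₁ (show k = (i : ℕ) + 1 + 1 + t by omega)
    obtain ⟨p, q, hp, hq, hpq⟩ := hlink i i₁ rfl hi₁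
    rw [hgap] at hdom
    rw [hgap', ← inv_two_sub_one_sub_one_div (by positivity)]
    refine hdom.of_linked ?_ (sub_lt_self 1 (by positivity))
      (eventually_feasibleAtTop.2 ⟨0, fun x _ hx _ => hx⟩)
      (fun j hj => hA j ((Fin.le_def.1 hj).trans_lt hi₁)) rfl hp hq hpq
    rw [sub_nonneg, div_le_one (by positivity)]
    linarith [Nat.cast_nonneg (α := ℝ) t]

theorem DominatesLater.exists_mul_rpow_le {i j : Fin m} {α : ℝ} (hα : 0 < α)
    (hi : DominatesLater l α⁻¹ i) (hj : Tendsto (fun x => x j) l atTop) (hij : i < j) :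
    ∃ d > 0, ∀ᶠ x in l, d * x j ^ α ≤ x i := by
  have hO : (fun x => x j ^ α) =O[l] fun x => x i :=
    (rpow_isBigO_iff hα (hj.eventually_ge_atTop 0) (hi.tendsto.eventually_ge_atTop 0)).2
      (hi.isBigO j hij)
  obtain ⟨c, hc, hbound⟩ := hO.exists_pos
  refine ⟨c⁻¹, inv_pos.2 hc, ?_⟩
  filter_upwards [hbound.bound, hi.tendsto.eventually_ge_atTop 0] with x hx hxi
  rw [inv_mul_le_iff₀ hc, ← Real.norm_of_nonneg hxi]
  exact (le_abs_self _).trans hx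

theorem IsLinked.exists_growth {lev : Fin n → ℕ} (hlink : IsLinked k lev A) (hk : k ≤ m)
    (hA : IsLevelFRSeq k lev A) (B : Matrix (Fin n) (Fin n) ℝ)
    (xbar : {i : Fin m // k ≤ (i : ℕ)} → ℝ) :
    ∃ d : Fin m → ℝ, (∀ j, 0 < d j) ∧ ∀ᶠ x in feasibleAtTop A B xbar,
      (∀ i : Fin m, (i : ℕ) < k → 0 < x i) ∧
      ∀ i j : Fin m, (j : ℕ) = i + 1 → (j : ℕ) < k →
        d j * x j ^ (1 + 1 / ((k : ℝ) - (j : ℕ))) ≤ x i := by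
  have hdom := hlink.dominatesLater (B := B) hk hA xbar
  have hexists (j : Fin m) : ∃ d > 0, ∀ᶠ x in feasibleAtTop A B xbar, ∀ i : Fin m,
      (j : ℕ) = i + 1 → (j : ℕ) < k → d * x j ^ (1 + 1 / ((k : ℝ) - (j : ℕ))) ≤ x i := by
    by_cases hj : 0 < (j : ℕ) ∧ (j : ℕ) < k
    · let i : Fin m := ⟨j - 1, by omega⟩
      have hij : (j : ℕ) = i + 1 := by simp only [i]; omega
      have hgap : 0 < (k : ℝ) - (j : ℕ) := sub_pos.2 (Nat.cast_lt.2 hj.2)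
      have hi := hdom i (by omega)
      rw [show (k : ℝ) - (i : ℕ) = k - (j : ℕ) + 1 by rw [hij]; push_cast; ring,
        ← inv_two_sub_one_sub_one_div hgap,
        show 2 - (1 - 1 / ((k : ℝ) - (j : ℕ))) = 1 + 1 / ((k : ℝ) - (j : ℕ)) by ring] at hi
      obtain ⟨d, hd, hle⟩ := hi.exists_mul_rpow_le (by positivity) (hdom j hj.2).tendsto (by omega)
      refine ⟨d, hd, hle.mono fun x hx i' hi' _ => ?_⟩
      rwa [show i' = i by omega]
    · exact ⟨1, one_pos, .of_forall fun x i hi hjk => absurd ⟨by omega, hjk⟩ hj⟩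
  choose d hd hle using hexists
  refine ⟨d, hd, ?_⟩
  have hpos : ∀ᶠ x in feasibleAtTop A B xbar, ∀ i : Fin m, (i : ℕ) < k → 0 < x i :=
    eventually_all.2 fun i => eventually_imp_distrib_left.2 fun hi =>
      (hdom i hi).tendsto.eventually_gt_atTop 0
  filter_upwards [eventually_all.2 hle, hpos] with x hx hpos
  exact ⟨hpos, fun i j => hx j i⟩

end Growth

theorem theorem1_general {m n k : ℕ} {A : Fin m → Matrix (Fin n) (Fin n) ℝ}
    {B : Matrix (Fin n) (Fin n) ℝ} (hk : k ≤ m) (r : Fin k → ℕ)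
    (hr : IsRegularFRSeq r fun i => A (Fin.castLE hk i))
    (hmin : ∀ (k' : ℕ) (A' : Fin m → Matrix (Fin n) (Fin n) ℝ) (B' : Matrix (Fin n) (Fin n) ℝ)
      (hk' : k' ≤ m) (r' : Fin k' → ℕ), IsReformulation A B A' B' →
      IsRegularFRSeq r' (fun i => A' (Fin.castLE hk' i)) → ∑ i, r' i = ∑ i, r i → k ≤ k')
    (xbar : {i : Fin m // k ≤ (i : ℕ)} → ℝ) (hxbar : PartiallyStrictlyFeasible A B xbar) :
    (∀ M : ℝ, ∃ x : Fin m → ℝ, Completes xbar x ∧ StrictlyFeasible A B x ∧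
      ∀ i : Fin m, (i : ℕ) + 1 = k → M ≤ x i) ∧
    ∃ d α : Fin m → ℝ,
      (∀ j : Fin m, 0 < (j : ℕ) → (j : ℕ) < k →
        0 < d j ∧ α j ≤ 2 ∧ 1 + 1 / ((k : ℝ) - ((j : ℕ) : ℝ)) ≤ α j) ∧
      ∃ K : ℝ, ∀ x : Fin m → ℝ, Completes xbar x → StrictlyFeasible A B x →
        (∀ i : Fin m, (i : ℕ) + 1 = k → K ≤ x i) →
        (∀ i : Fin m, (i : ℕ) < k → 0 < x i) ∧
        ∀ i j : Fin m, (j : ℕ) = (i : ℕ) + 1 → (j : ℕ) < k → d j * x j ^ α j ≤ x i := by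
  obtain ⟨lev, hlev, hA, hcard⟩ := hr.exists_isLevelFRSeq
  have hlink : IsLinked k lev A := hA.isLinked_of_minimal hlev hk
    fun k' A' B' hk' r' href hr' hsum => hmin k' A' B' hk' r' href hr' (hsum.trans hcard)
  obtain ⟨d, hd, hgrow⟩ := hlink.exists_growth hk hA B xbar
  obtain ⟨K, hK⟩ := eventually_feasibleAtTop.1 hgrow
  refine ⟨fun M => ?_, d, fun j => 1 + 1 / ((k : ℝ) - (j : ℕ)), fun j _ hj => ⟨hd j, ?_, le_rfl⟩,
    K, hK⟩
  · obtain ⟨x, hx, hfeas, hM⟩ := hA.exists_strictlyFeasible_ge hk hxbar M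
    exact ⟨x, hx, hfeas, fun i hi => hM i (by omega)⟩
  · have hgap : (1 : ℝ) ≤ k - (j : ℕ) := by
      rw [le_sub_iff_add_le']
      exact_mod_cast hj
    linarith [(div_le_one (zero_lt_one.trans_le hgap)).2 hgap]

/-- Indices in `Fin m` start at `0`: the variables `x_1, …, x_k` are the `x i` with `i < k`, and
`x_k` is the `x i` with `i + 1 = k`. For consecutive indices `i`, `j = i + 1 < k` the inequality
`x i ≥ d j * x j ^ α j` is the one between the `j`-th and the `(j + 1)`-st variable. -/
theorem theorem1 {m n : ℕ} (A : Fin m → Matrix (Fin n) (Fin n) ℝ) (B : Matrix (Fin n) (Fin n) ℝ)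
    (hA : ∀ i, (A i).IsSymm) (hB : B.IsSymm)
    (hP : ∃ x : Fin m → ℝ, StrictlyFeasible A B x)
    (k : ℕ) (A' : Fin m → Matrix (Fin n) (Fin n) ℝ) (B' : Matrix (Fin n) (Fin n) ℝ)
    (hform : IsRegularizedForm A B k A' B')
    (hmin : ∀ (k' : ℕ) (A'' : Fin m → Matrix (Fin n) (Fin n) ℝ) (B'' : Matrix (Fin n) (Fin n) ℝ),
      IsRegularizedForm A B k' A'' B'' → k ≤ k')
    (xbar : {i : Fin m // k ≤ (i : ℕ)} → ℝ)
    (hxbar : PartiallyStrictlyFeasible A' B' xbar) :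
    (∀ M : ℝ, ∃ x : Fin m → ℝ, Completes xbar x ∧ StrictlyFeasible A' B' x ∧
      ∀ i : Fin m, (i : ℕ) + 1 = k → M ≤ x i) ∧
    ∃ d α : Fin m → ℝ,
      (∀ j : Fin m, 0 < (j : ℕ) → (j : ℕ) < k →
        0 < d j ∧ α j ≤ 2 ∧ 1 + 1 / ((k : ℝ) - ((j : ℕ) : ℝ)) ≤ α j) ∧
      ∃ K : ℝ, ∀ x : Fin m → ℝ, Completes xbar x → StrictlyFeasible A' B' x →
        (∀ i : Fin m, (i : ℕ) + 1 = k → K ≤ x i) →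
        (∀ i : Fin m, (i : ℕ) < k → 0 < x i) ∧
        ∀ i j : Fin m, (j : ℕ) = (i : ℕ) + 1 → (j : ℕ) < k → d j * x j ^ α j ≤ x i := by
  obtain ⟨href, hk, r, hr, hrank⟩ := hform
  exact theorem1_general hk r hr (fun k' A'' B'' hk' r' href' hr' hsum =>
    hmin k' A'' B'' ⟨href.trans href', hk', r', hr', hsum ▸ hrank⟩) xbar hxbar
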